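/- **Setting.** Let $d,N\ge 1$, $0<\alpha<1$, and let $\mathbb P^*$ be a Borel probability measure on $\mathbb R^d$ with independent components and $\mathrm{supp}(\mathbb P^*)\subseteq[\hat{\mathbf u}^{(0)},\hat{\mathbf u}^{(N+1)}]=\{\mathbf u\in\mathbb R^d:\hat u_i^{(0)}\le u_i\le \hat u_i^{(N+1)},\ i=1,\dots,d\}$, a known finite box. Let $\mathcal S=\{\hat{\mathbf u}^1,\dots,\hat{\mathbf u}^N\}$ be drawn i.i.d. from $\mathbb P^*$, and for $1\le j\le N$ let $\hat u_i^{(j)}$ be the $j$-th smallest of $\hat u_i^1,\dots,\hat u_i^N$. Let $\Gamma^{KS}$ be a threshold of the Kolmogorov–Smirnov test with $N$ data points at level $\alpha'=1-\sqrt[d]{1-\alpha}$: a real number $\Gamma^{KS}\le 1$ that is at least the exact critical value (e.g. that value itself), i.e. the least $t$ such that, for the order statistics $w^{(1)}\le\dots\le w^{(N)}$ of $N$ independent random variables uniform on $[0,1]$, $\max_{1\le j\le N}\max\left(\tfrac jN-w^{(j)},\,w^{(j)}-\tfrac{j-1}N\right)$ exceeds $t$ with probability at most $\alpha'$. For $0\le\Gamma\le1$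 put $q^L_0(\Gamma)=\Gamma$; $q^L_j(\Gamma)=\frac1N$ for $1\le j\le\lfloor N(1-\Gamma)\rfloor$; $q^L_j(\Gamma)=1-\Gamma-\frac{\lfloor N(1-\Gamma)\rfloor}{N}$ for $j=\lfloor N(1-\Gamma)\rfloor+1$; $q^L_j(\Gamma)=0$ for the other $j\le N+1$; and $q^R_j(\Gamma)=q^L_{N+1-j}(\Gamma)$ for $0\le j\le N+1$. Let $\Delta_{N+2}$ be the probability simplex in $\mathbb R^{N+2}$ and $D(\mathbf p,\mathbf r)=\sum_j p_j\log(p_j/r_j)$ the relative entropy (with $0\log(0/r)=0$ for $r\ge0$, and $p\log(p/0)=\infty$ for $p>0$). For $0<\epsilon<1$ define $$\mathcal U^I_\epsilon=\Big\{\mathbf u\in\mathbb R^d:\ \exists\,\theta_i\in[0,1],\ \mathbf q^i\in\Delta_{N+2}\ (i=1,\dots,d),\ \sum_{j=0}^{N+1}\hat u_i^{(j)}q^i_j=u_i\ \forall i,\ \sum_{i=1}^dD\big(\mathbf q^i,\theta_i\mathbf q^L(\Gamma^{KS})+(1-\theta_i)\mathbf q^R(\Gamma^{KS})\big)\le\log(1/\epsilon)\Big\}.$$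 **Theorem.** (1) With probability at least $1-\alpha$ with respect to the sampling, the family $\{\mathcal U^I_\epsilon:0<\epsilon<1\}$ simultaneously implies a probabilistic guarantee for $\mathbb P^*$; that is, for all $0<\epsilon<1$, all $k$, every real-valued function $f(\mathbf u,\mathbf x)$ on $\mathbb R^d\times\mathbb R^k$ that is concave in $\mathbf u$ for all $\mathbf x$, and every $\mathbf x^*\in\mathbb R^k$: if $f(\mathbf u,\mathbf x^*)\le0$ for all $\mathbf u\in\mathcal U^I_\epsilon$, then $\mathbb P^*(f(\tilde{\mathbf u},\mathbf x^*)\le0)\ge1-\epsilon$. (2) Moreover, for every sample, every $0<\epsilon<1$ and every $\mathbf v\in\mathbb R^d$, the support function $\delta^*(\mathbf v|\,\mathcal U^I_\epsilon)=\sup_{\mathbf u\in\mathcal U^I_\epsilon}\mathbf v^T\mathbf u$ is given by $$\delta^*(\mathbf v|\,\mathcal U^I_\epsilon)=\inf_{\lambda>0}\left\{\lambda\log(1/\epsilon)+\lambda\sum_{i=1}^d\log\left[\max\left(\sum_{j=0}^{N+1}q^L_j(\Gamma^{KS})e^{v_i\hat u_i^{(j)}/\lambda},\ \sum_{j=0}^{N+1}q^R_j(\Gamma^{KS})e^{v_i\hat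 u_i^{(j)}/\lambda}\right)\right]\right\}.$$ -/

import Mathlib

open MeasureTheory ProbabilityTheory
open scoped ENNReal

noncomputable section

/-- The sample `s` sorted in nondecreasing order: `sortedSample s j` (with `j` counted from `0`)
is the `(j + 1)`-th smallest of the `N` data points. -/
def sortedSample {N : ℕ} (s : Fin N → ℝ) : Fin N → ℝ :=
  s ∘ Tuple.sort s

/-- The points `u^(0), u^(1), ..., u^(N), u^(N+1)`: the order statistics of the sample `s`, preceded
by the left end point `a` and followed by the right end point `b` of the known support interval. -/
def orderPoints {N : ℕ} (a b : ℝ) (s : Fin N → ℝ) : Fin (N + 2) → ℝ :=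
  Fin.cons a (Fin.snoc (sortedSample s) b : Fin (N + 1) → ℝ)

/-- The Kolmogorov-Smirnov statistic of the sample `s` for the null hypothesis that the data are
drawn from `μ`. The index `j : Fin N` counts from `0`. -/
def ksStatistic {N : ℕ} (s : Fin N → ℝ) (μ : Measure ℝ) : ℝ :=
  ⨆ j : Fin N,
    max (((j : ℝ) + 1) / N - μ.real (Set.Iic (sortedSample s j)))
      (μ.real (Set.Iio (sortedSample s j)) - (j : ℝ) / N)

/-- The uniform distribution on `[0, 1]`. -/
def uniformUnit : Measure ℝ := volume.restrict (Set.Icc 0 1)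

/-- The exact critical value of the Kolmogorov-Smirnov test with `N` data points at significance
level `β`: the least `t` such that the statistic of `N` i.i.d. uniform variables exceeds `t` with
probability at most `β`. (The null distribution of the statistic is the same for all continuous
null hypotheses.) -/
def ksThreshold (N : ℕ) (β : ℝ) : ℝ :=
  sInf {t : ℝ | Measure.pi (fun _ : Fin N => uniformUnit)
    {s | t < ksStatistic s uniformUnit} ≤ ENNReal.ofReal β}

/-- The vector `q^L(Γ)`. -/
def qL (N : ℕ) (Γ : ℝ) (j : Fin (N + 2)) : ℝ :=
  if (j : ℕ) = 0 then Γ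
  else if (j : ℕ) ≤ ⌊(N : ℝ) * (1 - Γ)⌋₊ then 1 / (N : ℝ)
  else if (j : ℕ) = ⌊(N : ℝ) * (1 - Γ)⌋₊ + 1 then
    1 - Γ - (⌊(N : ℝ) * (1 - Γ)⌋₊ : ℝ) / (N : ℝ)
  else 0

/-- The vector `q^R(Γ)`, given by `q^R_j = q^L_{N+1-j}`. -/
def qR (N : ℕ) (Γ : ℝ) (j : Fin (N + 2)) : ℝ :=
  qL N Γ (Fin.rev j)

/-- The relative entropy `D(p, r) = ∑ p_j log (p_j / r_j)` of two nonnegative vectors, with the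
usual conventions `0 log (0 / r) = 0` (also for `r = 0`) and `p log (p / 0) = ∞` for `p > 0`. -/
def relEntropy {n : ℕ} (p r : Fin n → ℝ) : EReal :=
  ∑ j, if p j = 0 then (0 : EReal)
    else if r j = 0 then ⊤
    else ((p j * Real.log (p j / r j) : ℝ) : EReal)

/-- The uncertainty set `U^I_ε` built from the sample `S` (`S k i` is the `i`-th component of the
`k`-th data point), the box `[a, b]` and the threshold `Γ`. -/
def uncertaintySet {d N : ℕ} (a b : Fin d → ℝ) (Γ : ℝ) (S : Fin N → Fin d → ℝ) (ε : ℝ) :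
    Set (Fin d → ℝ) :=
  {u | ∃ (θ : Fin d → ℝ) (q : Fin d → Fin (N + 2) → ℝ),
    (∀ i, θ i ∈ Set.Icc (0 : ℝ) 1) ∧
    (∀ i, q i ∈ stdSimplex ℝ (Fin (N + 2))) ∧
    (∀ i, ∑ j, orderPoints (a i) (b i) (fun k => S k i) j * q i j = u i) ∧
    ∑ i, relEntropy (q i) (fun j => θ i * qL N Γ j + (1 - θ i) * qR N Γ j)
      ≤ ((Real.log (1 / ε) : ℝ) : EReal)}

/-- The support function `δ*(v | U) = sup_{u ∈ U} v ⬝ u`, with values in the extended reals. -/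
def supportFunction {d : ℕ} (v : Fin d → ℝ) (U : Set (Fin d → ℝ)) : EReal :=
  ⨆ u ∈ U, ((∑ i, v i * u i : ℝ) : EReal)

/-- `U` implies a probabilistic guarantee for `P` at level `ε`: for every `f (u, x)` that is concave
in `u` for all `x`, every `x` that is robust feasible over `U` satisfies the constraint with
`P`-probability at least `1 - ε`. -/
def ImpliesGuarantee {d : ℕ} (P : Measure (Fin d → ℝ)) (ε : ℝ) (U : Set (Fin d → ℝ)) : Prop :=
  ∀ (k : ℕ) (f : (Fin d → ℝ) → (Fin k → ℝ) → ℝ),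
    (∀ x, ConcaveOn ℝ Set.univ (fun u => f u x)) →
    ∀ x, (∀ u ∈ U, f u x ≤ 0) → ENNReal.ofReal (1 - ε) ≤ P {u | f u x ≤ 0}

/-- The family `U ε`, `0 < ε < 1`, simultaneously implies a probabilistic guarantee for `P`. -/
def SimultaneouslyImpliesGuarantee {d : ℕ} (P : Measure (Fin d → ℝ))
    (U : ℝ → Set (Fin d → ℝ)) : Prop :=
  ∀ ε ∈ Set.Ioo (0 : ℝ) 1, ImpliesGuarantee P ε (U ε)

/-- The objective of the one-dimensional problem for the support function of `U^I_ε`. -/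
def dualObjective {d N : ℕ} (a b : Fin d → ℝ) (Γ : ℝ) (S : Fin N → Fin d → ℝ) (ε : ℝ)
    (v : Fin d → ℝ) (l : ℝ) : ℝ :=
  l * Real.log (1 / ε) + l * ∑ i, Real.log
    (max (∑ j, qL N Γ j * Real.exp (v i * orderPoints (a i) (b i) (fun k => S k i) j / l))
      (∑ j, qR N Γ j * Real.exp (v i * orderPoints (a i) (b i) (fun k => S k i) j / l)))

end

/-! ### The vectors `q^L` and `q^R` -/

theorem qL_nonneg {N : ℕ} {Γ : ℝ} (h0 : 0 ≤ Γ) (h1 : Γ ≤ 1) (j : Fin (N + 2)) : 0 ≤ qL N Γ j := by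
  have hx : (0 : ℝ) ≤ N * (1 - Γ) := mul_nonneg (Nat.cast_nonneg _) (by linarith)
  unfold qL
  split_ifs
  · exact h0
  · positivity
  · rw [sub_nonneg]
    refine div_le_of_le_mul₀ (Nat.cast_nonneg _) (by linarith) ?_
    exact (Nat.floor_le hx).trans_eq (mul_comm _ _)
  · exact le_rfl

theorem qR_nonneg {N : ℕ} {Γ : ℝ} (h0 : 0 ≤ Γ) (h1 : Γ ≤ 1) (j : Fin (N + 2)) : 0 ≤ qR N Γ j :=
  qL_nonneg h0 h1 _

/-- The initial partial sums of `q^L`. -/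
theorem sum_qL_filter_le {N : ℕ} {Γ : ℝ} (h0 : 0 ≤ Γ) (h1 : Γ ≤ 1) {k : ℕ}
    (hk : k ≤ N) :
    min 1 (Γ + k / N) ≤ ∑ j : Fin (N + 2) with j.val ≤ k, qL N Γ j := by
  set m := ⌊(N : ℝ) * (1 - Γ)⌋₊ with hm
  let g : ℕ → ℝ := fun j => if j = 0 then Γ else if j ≤ m then 1 / (N : ℝ)
    else if j = m + 1 then 1 - Γ - (m : ℝ) / (N : ℝ) else 0
  have hg : ∀ j : Fin (N + 2), qL N Γ j = g j := fun j => rfl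
  have hpart : ∀ i ≤ m, ∑ j ∈ Finset.range (i + 1), g j = Γ + i / N := by
    intro i
    induction i with
    | zero => intro _; simp [g]
    | succ i ih =>
      intro hi
      rw [Finset.sum_range_succ, ih (by omega)]
      have : g (i + 1) = 1 / N := by simp [g, hi]
      rw [this]
      push_cast
      ring
  have hsum : ∑ j : Fin (N + 2) with j.val ≤ k, qL N Γ j = ∑ j ∈ Finset.range (k + 1), g j := by
    simp_rw [hg]
    rw [Finset.sum_filter, Fin.sum_univ_eq_sum_range (fun j => if j ≤ k then g j else 0) (N + 2),
      ← Finset.sum_filter]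
    refine Finset.sum_congr ?_ fun _ _ => rfl
    ext j
    simp only [Finset.mem_filter, Finset.mem_range]
    omega
  rw [hsum]
  by_cases hkm : k ≤ m
  · rw [hpart k hkm]
    exact min_le_right _ _
  · refine (min_le_left _ _).trans ?_
    have hge : ∑ j ∈ Finset.range (m + 2), g j = 1 := by
      rw [Finset.sum_range_succ, hpart m le_rfl]
      simp [g]
    rw [← hge]
    refine Finset.sum_le_sum_of_subset_of_nonneg
      (Finset.range_subset_range.2 (by omega)) fun j hj _ => ?_
    rw [Finset.mem_range] at hj
    exact hg ⟨j, by omega⟩ ▸ qL_nonneg h0 h1 _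

theorem floor_mul_one_sub_le {N : ℕ} {Γ : ℝ} (h0 : 0 ≤ Γ) :
    ⌊(N : ℝ) * (1 - Γ)⌋₊ ≤ N := by
  rw [← Nat.cast_le (α := ℝ)]
  rcases le_total Γ 1 with h | h
  · refine (Nat.floor_le (mul_nonneg (Nat.cast_nonneg _) (by linarith))).trans ?_
    nlinarith [Nat.cast_nonneg (α := ℝ) N]
  · rw [Nat.floor_of_nonpos (mul_nonpos_of_nonneg_of_nonpos (Nat.cast_nonneg _) (by linarith))]
    simp

theorem sum_qL {N : ℕ} {Γ : ℝ} (hN : 1 ≤ N) (h0 : 0 ≤ Γ) : ∑ j, qL N Γ j = 1 := by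
  have hmN := floor_mul_one_sub_le (N := N) h0
  have hN' : (N : ℝ) ≠ 0 := by positivity
  set m := ⌊(N : ℝ) * (1 - Γ)⌋₊ with hm
  let g : ℕ → ℝ := fun j => if j = 0 then Γ else if j ≤ m then 1 / (N : ℝ)
    else if j = m + 1 then 1 - Γ - (m : ℝ) / (N : ℝ) else 0
  have hg : ∀ j : Fin (N + 2), qL N Γ j = g j := fun j => rfl
  simp_rw [hg]
  rw [Fin.sum_univ_eq_sum_range g (N + 2), Finset.sum_range_succ']
  have : ∀ j ∈ Finset.range (N + 1), g (j + 1) =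
      (if j < m then 1 / (N : ℝ) else 0) + if j = m then 1 - Γ - (m : ℝ) / N else 0 := by
    intro j _
    simp only [g, if_neg (Nat.succ_ne_zero j)]
    split_ifs <;> first | omega | simp
  rw [Finset.sum_congr rfl this, Finset.sum_add_distrib, Finset.sum_ite_eq', ← Finset.sum_filter]
  have hf : (Finset.range (N + 1)).filter (· < m) = Finset.range m := by
    ext j
    simp only [Finset.mem_filter, Finset.mem_range]
    omega
  rw [hf, if_pos (Finset.mem_range.2 (by omega))]
  simp [g]
  field_simp
  ring

theorem sum_qR {N : ℕ} {Γ : ℝ} (hN : 1 ≤ N) (h0 : 0 ≤ Γ) : ∑ j, qR N Γ j = 1 :=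
  (Equiv.sum_comp Fin.revPerm (qL N Γ)).trans (sum_qL hN h0)

/-! ### Relative entropy -/

/-- The Fenchel-Young inequality for `p ↦ p log (p / r)`. -/
theorem mul_sub_mul_exp_le_mul_log_div {p r : ℝ} (hp : 0 ≤ p) (hr : 0 ≤ r) (h : r = 0 → p = 0)
    (y : ℝ) : p * y - r * Real.exp (y - 1) ≤ p * Real.log (p / r) := by
  rcases hp.eq_or_lt with rfl | hp
  · simp
    positivity
  · have hr : 0 < r := lt_of_le_of_ne hr fun h' => hp.ne' (h h'.symm)
    have h1 := Real.add_one_le_exp (y - 1 - Real.log (p / r))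
    rw [Real.exp_sub, Real.exp_log (by positivity)] at h1
    have h2 := mul_le_mul_of_nonneg_left h1 hp.le
    have h3 : p * (Real.exp (y - 1) / (p / r)) = r * Real.exp (y - 1) := by field_simp
    rw [h3] at h2
    linarith

/-- Joint convexity of `(p, r) ↦ p log (p / r)`. -/
theorem mul_log_div_convex {p p' r r' s t : ℝ} (hp : 0 ≤ p) (hp' : 0 ≤ p') (hr : 0 ≤ r)
    (hr' : 0 ≤ r') (h : r = 0 → p = 0) (h' : r' = 0 → p' = 0) (hs : 0 ≤ s) (ht : 0 ≤ t) :
    (s * p + t * p') * Real.log ((s * p + t * p') / (s * r + t * r')) ≤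
      s * (p * Real.log (p / r)) + t * (p' * Real.log (p' / r')) := by
  set P := s * p + t * p' with hP
  set R := s * r + t * r' with hR
  have hP0 : 0 ≤ P := by positivity
  have hR0 : 0 ≤ R := by positivity
  by_cases hPz : P = 0
  · have h1 : s * p = 0 := by nlinarith [mul_nonneg hs hp, mul_nonneg ht hp']
    have h2 : t * p' = 0 := by nlinarith [mul_nonneg hs hp, mul_nonneg ht hp']
    rw [hPz, ← mul_assoc, ← mul_assoc, h1, h2]
    simp
  · have hPpos : 0 < P := lt_of_le_of_ne hP0 (Ne.symm hPz)
    have hRpos : 0 < R := by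
      refine lt_of_le_of_ne hR0 fun hRz => hPz ?_
      have h1 : s * r = 0 := by nlinarith [mul_nonneg hs hr, mul_nonneg ht hr']
      have h2 : t * r' = 0 := by nlinarith [mul_nonneg hs hr, mul_nonneg ht hr']
      rw [hP]
      rcases mul_eq_zero.1 h1 with h1 | h1 <;> rcases mul_eq_zero.1 h2 with h2 | h2 <;>
        simp [h1, h2, h, h']
    have e1 := mul_le_mul_of_nonneg_left
      (mul_sub_mul_exp_le_mul_log_div hp hr h (1 + Real.log (P / R))) hs
    have e2 := mul_le_mul_of_nonneg_left
      (mul_sub_mul_exp_le_mul_log_div hp' hr' h' (1 + Real.log (P / R))) ht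
    rw [add_sub_cancel_left, Real.exp_log (by positivity)] at e1 e2
    have e3 : R * (P / R) = P := by field_simp
    have e4 : s * (p * (1 + Real.log (P / R)) - r * (P / R)) +
        t * (p' * (1 + Real.log (P / R)) - r' * (P / R)) =
        P * (1 + Real.log (P / R)) - R * (P / R) := by rw [hP, hR]; ring
    rw [e3] at e4
    linarith

section Gibbs

variable {ι : Type*} [Fintype ι]

/-- The Gibbs variational inequality. -/
theorem sum_mul_sub_entropy_le_log {q r : ι → ℝ} (hq : q ∈ stdSimplex ℝ ι) (hr : ∀ j, 0 ≤ r j)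
    (hac : ∀ j, r j = 0 → q j = 0) (y : ι → ℝ) (hZ : 0 < ∑ j, r j * Real.exp (y j)) :
    ∑ j, q j * y j - ∑ j, q j * Real.log (q j / r j) ≤ Real.log (∑ j, r j * Real.exp (y j)) := by
  set Z := ∑ j, r j * Real.exp (y j) with hZdef
  have h := Finset.sum_le_sum fun j (_ : j ∈ Finset.univ) =>
    mul_sub_mul_exp_le_mul_log_div (hq.1 j) (hr j) (hac j) (y j - Real.log Z + 1)
  have e : ∑ j, (q j * (y j - Real.log Z + 1) - r j * Real.exp (y j - Real.log Z + 1 - 1)) =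
      ∑ j, q j * y j - Real.log Z * ∑ j, q j + ∑ j, q j - Z / Z := by
    rw [hZdef, Finset.sum_div, Finset.mul_sum, ← Finset.sum_sub_distrib, ← Finset.sum_add_distrib,
      ← Finset.sum_sub_distrib, ← hZdef]
    refine Finset.sum_congr rfl fun j _ => ?_
    rw [add_sub_cancel_right, Real.exp_sub, Real.exp_log hZ]
    ring
  rw [e, hq.2, div_self hZ.ne'] at h
  linarith

/-- Equality in the Gibbs variational inequality. -/
theorem exists_sum_mul_sub_entropy_eq_log {r : ι → ℝ} (hr : ∀ j, 0 ≤ r j) (y : ι → ℝ)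
    (hZ : 0 < ∑ j, r j * Real.exp (y j)) :
    ∃ q ∈ stdSimplex ℝ ι, (∀ j, r j = 0 → q j = 0) ∧
      ∑ j, q j * y j - ∑ j, q j * Real.log (q j / r j) =
        Real.log (∑ j, r j * Real.exp (y j)) := by
  set Z := ∑ j, r j * Real.exp (y j) with hZdef
  have hsum : ∑ j, r j * Real.exp (y j) / Z = 1 := by
    rw [← Finset.sum_div, ← hZdef, div_self hZ.ne']
  refine ⟨fun j => r j * Real.exp (y j) / Z, ⟨fun j => ?_, hsum⟩, fun j hj => by simp [hj], ?_⟩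
  · have := hr j
    positivity
  · have hterm : ∀ j, r j * Real.exp (y j) / Z * Real.log (r j * Real.exp (y j) / Z / r j) =
        r j * Real.exp (y j) / Z * (y j - Real.log Z) := by
      intro j
      by_cases hj : r j = 0
      · simp [hj]
      · congr 1
        rw [show r j * Real.exp (y j) / Z / r j = Real.exp (y j) / Z by field_simp,
          Real.log_div (Real.exp_ne_zero _) hZ.ne', Real.log_exp]
    simp_rw [hterm, mul_sub, Finset.sum_sub_distrib, ← Finset.sum_mul, hsum]
    ring

end Gibbs

theorem EReal.sum_coe {ι : Type*} (s : Finset ι) (f : ι → ℝ) :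
    ∑ j ∈ s, (f j : EReal) = ((∑ j ∈ s, f j : ℝ) : EReal) := by
  classical
  induction s using Finset.induction_on with
  | empty => simp
  | insert a s ha ih => rw [Finset.sum_insert ha, Finset.sum_insert ha, ih, EReal.coe_add]

theorem EReal.sum_ne_bot {ι : Type*} (s : Finset ι) (f : ι → EReal) (h : ∀ j ∈ s, f j ≠ ⊥) :
    ∑ j ∈ s, f j ≠ ⊥ := by
  classical
  induction s using Finset.induction_on with
  | empty => simp
  | insert a s ha ih =>
    rw [Finset.sum_insert ha, Ne, EReal.add_eq_bot_iff, not_or]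
    exact ⟨h a (by simp), ih fun j hj => h j (by simp [hj])⟩

theorem EReal.sum_eq_top {ι : Type*} (s : Finset ι) (f : ι → EReal) (h : ∀ j ∈ s, f j ≠ ⊥)
    {i : ι} (hi : i ∈ s) (hf : f i = ⊤) : ∑ j ∈ s, f j = ⊤ := by
  classical
  rw [← Finset.add_sum_erase s f hi, hf]
  exact EReal.top_add_of_ne_bot
    (EReal.sum_ne_bot _ _ fun j hj => h j (Finset.mem_of_mem_erase hj))

theorem relEntropy_of_ac {n : ℕ} {p r : Fin n → ℝ} (h : ∀ j, r j = 0 → p j = 0) :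
    relEntropy p r = ((∑ j, p j * Real.log (p j / r j) : ℝ) : EReal) := by
  rw [relEntropy, ← EReal.sum_coe]
  refine Finset.sum_congr rfl fun j _ => ?_
  by_cases hp : p j = 0
  · simp [hp]
  · rw [if_neg hp, if_neg fun hr => hp (h j hr)]

theorem relEntropy_of_not_ac {n : ℕ} {p r : Fin n → ℝ} (h : ¬ ∀ j, r j = 0 → p j = 0) :
    relEntropy p r = ⊤ := by
  push Not at h
  obtain ⟨j, hr, hp⟩ := h
  refine EReal.sum_eq_top _ _ (fun i _ => ?_) (Finset.mem_univ j) (by simp [hr, hp])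
  split_ifs
  · simp
  · simp
  · exact EReal.coe_ne_bot _

theorem sum_relEntropy_le_iff {d n : ℕ} {p r : Fin d → Fin n → ℝ} {ρ : ℝ} :
    ∑ i, relEntropy (p i) (r i) ≤ (ρ : EReal) ↔
      (∀ i j, r i j = 0 → p i j = 0) ∧ ∑ i, ∑ j, p i j * Real.log (p i j / r i j) ≤ ρ := by
  by_cases h : ∀ i j, r i j = 0 → p i j = 0
  · rw [Finset.sum_congr rfl fun i _ => relEntropy_of_ac (h i), EReal.sum_coe, EReal.coe_le_coe_iff]
    exact ⟨fun h' => ⟨h, h'⟩, fun h' => h'.2⟩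
  · refine iff_of_false ?_ fun h' => h h'.1
    push Not at h
    obtain ⟨i, hi⟩ := h
    rw [EReal.sum_eq_top _ _ (fun i _ => ?_) (Finset.mem_univ i)
      (relEntropy_of_not_ac (by push Not; exact hi))]
    · simp
    · by_cases h : ∀ j, r i j = 0 → p i j = 0
      · rw [relEntropy_of_ac h]
        exact EReal.coe_ne_bot _
      · rw [relEntropy_of_not_ac h]
        simp

/-! ### Duality -/

/-- A Lagrange multiplier for a convex problem in epigraph form satisfying Slater's condition. -/
theorem exists_lagrange_multiplier {C : Set (ℝ × ℝ)} (hC : Convex ℝ C) {ρ c s₀ : ℝ} (hρ : 0 < ρ)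
    (h₀ : (s₀, (0 : ℝ)) ∈ C) (h : ∀ z ∈ C, z.2 ≤ ρ → z.1 ≤ c) :
    ∃ l : ℝ, 0 ≤ l ∧ ∀ z ∈ C, z.1 - l * z.2 ≤ c - l * ρ := by
  have hdisj : Disjoint (Set.Ioi c ×ˢ Set.Iio ρ) C := by
    rw [Set.disjoint_left]
    rintro z ⟨hz1, hz2⟩ hz
    exact absurd (h z hz (le_of_lt hz2)) (not_le.2 hz1)
  obtain ⟨f, w, hO, hCw⟩ := geometric_hahn_banach_open ((convex_Ioi c).prod (convex_Iio ρ))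
    (isOpen_Ioi.prod isOpen_Iio) hC hdisj
  set A := f (1, 0) with hA
  set B := f (0, 1) with hB
  have hf : ∀ s t : ℝ, f (s, t) = s * A + t * B := by
    intro s t
    have : ((s, t) : ℝ × ℝ) = s • ((1, 0) : ℝ × ℝ) + t • ((0, 1) : ℝ × ℝ) := by simp
    rw [this, map_add, map_smul, map_smul, smul_eq_mul, smul_eq_mul]
  have hO' : ∀ x y : ℝ, 0 < x → 0 < y → (c + x) * A + (ρ - y) * B < w := by
    intro x y hx hy
    rw [← hf]
    exact hO _ ⟨by simpa using hx, by simpa using hy⟩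
  have hA0 : A ≤ 0 := by
    by_contra! hA0
    have := hO' ((|w - c * A - (ρ - 1) * B| + 1) / A) 1 (by positivity) one_pos
    have e : (|w - c * A - (ρ - 1) * B| + 1) / A * A = |w - c * A - (ρ - 1) * B| + 1 := by
      field_simp
    have := le_abs_self (w - c * A - (ρ - 1) * B)
    nlinarith
  have hB0 : 0 ≤ B := by
    by_contra! hB0
    have := hO' 1 ((|w - (c + 1) * A - ρ * B| + 1) / (-B)) one_pos
      (div_pos (by positivity) (by linarith))
    have e : (|w - (c + 1) * A - ρ * B| + 1) / (-B) * B = -(|w - (c + 1) * A - ρ * B| + 1) := by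
      rw [div_neg, neg_mul, div_mul_cancel₀ _ hB0.ne]
    have := le_abs_self (w - (c + 1) * A - ρ * B)
    nlinarith
  have hlim : c * A + ρ * B ≤ w := by
    refine le_of_forall_pos_le_add fun δ hδ => ?_
    have hpos : 0 < δ / (B - A + 1) := div_pos hδ (by linarith)
    have h1 := hO' _ _ hpos hpos
    have e : δ / (B - A + 1) * (B - A + 1) = δ := div_mul_cancel₀ _ (by linarith)
    nlinarith
  have hA1 : A < 0 := by
    refine lt_of_le_of_ne hA0 fun hAz => ?_
    have h1 := hCw _ h₀
    rw [hf, hAz] at h1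
    rw [hAz] at hlim
    have hBz : B = 0 := le_antisymm (by nlinarith) hB0
    have := hO' 1 1 one_pos one_pos
    rw [hAz, hBz] at this
    linarith
  refine ⟨B / (-A), div_nonneg hB0 (by linarith), fun z hz => ?_⟩
  have h1 := hCw _ hz
  rw [show z = (z.1, z.2) from rfl, hf] at h1
  have h2 : 0 ≤ (z.1 * A + z.2 * B - (c * A + ρ * B)) / (-A) :=
    div_nonneg (by linarith) (by linarith)
  have e : (z.1 * A + z.2 * B - (c * A + ρ * B)) / (-A) =
      c - z.1 + B / (-A) * (z.2 - ρ) := by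
    have := hA1.ne
    field_simp
    ring
  rw [e] at h2
  nlinarith

/-- Pairs of a point `u` and an upper bound for the relative entropy budget that represents it. -/
def entropyEpigraph {d N : ℕ} (x : Fin d → Fin (N + 2) → ℝ) (Γ : ℝ) : Set ((Fin d → ℝ) × ℝ) :=
  {z | ∃ (θ : Fin d → ℝ) (q : Fin d → Fin (N + 2) → ℝ),
    (∀ i, θ i ∈ Set.Icc (0 : ℝ) 1) ∧
    (∀ i, q i ∈ stdSimplex ℝ (Fin (N + 2))) ∧
    (∀ i, ∑ j, x i j * q i j = z.1 i) ∧
    (∀ i j, θ i * qL N Γ j + (1 - θ i) * qR N Γ j = 0 → q i j = 0) ∧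
    ∑ i, ∑ j, q i j * Real.log (q i j / (θ i * qL N Γ j + (1 - θ i) * qR N Γ j)) ≤ z.2}

theorem mem_uncertaintySet_iff {d N : ℕ} {a b : Fin d → ℝ} {Γ : ℝ} {S : Fin N → Fin d → ℝ}
    {ε : ℝ} {u : Fin d → ℝ} :
    u ∈ uncertaintySet a b Γ S ε ↔
      (u, Real.log (1 / ε)) ∈
        entropyEpigraph (fun i => orderPoints (a i) (b i) fun k => S k i) Γ := by
  simp only [uncertaintySet, entropyEpigraph, Set.mem_ofPred_eq, sum_relEntropy_le_iff]

section Epigraph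

variable {d N : ℕ} {x : Fin d → Fin (N + 2) → ℝ} {Γ : ℝ}

theorem mixture_nonneg (h0 : 0 ≤ Γ) (h1 : Γ ≤ 1) {t : ℝ} (ht : t ∈ Set.Icc (0 : ℝ) 1)
    (j : Fin (N + 2)) : 0 ≤ t * qL N Γ j + (1 - t) * qR N Γ j :=
  add_nonneg (mul_nonneg ht.1 (qL_nonneg h0 h1 j))
    (mul_nonneg (by linarith [ht.2]) (qR_nonneg h0 h1 j))

theorem convex_entropyEpigraph (h0 : 0 ≤ Γ) (h1 : Γ ≤ 1) : Convex ℝ (entropyEpigraph x Γ) := by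
  rintro z ⟨θ, q, hθ, hq, hz, hac, hD⟩ z' ⟨θ', q', hθ', hq', hz', hac', hD'⟩ s t hs ht hst
  have hmix : ∀ i j, (s * θ i + t * θ' i) * qL N Γ j + (1 - (s * θ i + t * θ' i)) * qR N Γ j =
      s * (θ i * qL N Γ j + (1 - θ i) * qR N Γ j) +
        t * (θ' i * qL N Γ j + (1 - θ' i) * qR N Γ j) := by
    intro i j
    have : s = 1 - t := by linarith
    subst this
    ring
  have hn := fun i => mixture_nonneg (N := N) h0 h1 (hθ i)
  have hn' := fun i => mixture_nonneg (N := N) h0 h1 (hθ' i)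
  refine ⟨fun i => s * θ i + t * θ' i, fun i j => s * q i j + t * q' i j,
    fun i => convex_Icc (0 : ℝ) 1 (hθ i) (hθ' i) hs ht hst,
    fun i => convex_stdSimplex ℝ _ (hq i) (hq' i) hs ht hst, fun i => ?_, fun i j hij => ?_, ?_⟩
  · simp only [Prod.fst_add, Prod.smul_fst, Pi.add_apply, Pi.smul_apply, smul_eq_mul, ← hz, ← hz',
      Finset.mul_sum, ← Finset.sum_add_distrib]
    exact Finset.sum_congr rfl fun j _ => by ring
  · rw [hmix] at hij
    have h1 : s * (θ i * qL N Γ j + (1 - θ i) * qR N Γ j) = 0 := by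
      nlinarith [mul_nonneg hs (hn i j), mul_nonneg ht (hn' i j)]
    have h2 : t * (θ' i * qL N Γ j + (1 - θ' i) * qR N Γ j) = 0 := by
      nlinarith [mul_nonneg hs (hn i j), mul_nonneg ht (hn' i j)]
    have h3 : s * q i j = 0 := by
      rcases mul_eq_zero.1 h1 with h | h
      · rw [h, zero_mul]
      · rw [hac i j h, mul_zero]
    have h4 : t * q' i j = 0 := by
      rcases mul_eq_zero.1 h2 with h | h
      · rw [h, zero_mul]
      · rw [hac' i j h, mul_zero]
    change s * q i j + t * q' i j = 0
    rw [h3, h4, add_zero]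
  · have hle : ∀ i j, (s * q i j + t * q' i j) * Real.log ((s * q i j + t * q' i j) /
        ((s * θ i + t * θ' i) * qL N Γ j + (1 - (s * θ i + t * θ' i)) * qR N Γ j)) ≤
        s * (q i j * Real.log (q i j / (θ i * qL N Γ j + (1 - θ i) * qR N Γ j))) +
        t * (q' i j * Real.log (q' i j / (θ' i * qL N Γ j + (1 - θ' i) * qR N Γ j))) := by
      intro i j
      rw [hmix]
      exact mul_log_div_convex ((hq i).1 j) ((hq' i).1 j) (hn i j) (hn' i j) (hac i j) (hac' i j)
        hs ht
    refine (Finset.sum_le_sum fun i _ => Finset.sum_le_sum fun j _ => hle i j).trans ?_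
    simp only [Finset.sum_add_distrib, ← Finset.mul_sum]
    exact add_le_add (mul_le_mul_of_nonneg_left hD hs) (mul_le_mul_of_nonneg_left hD' ht)

theorem sum_mul_exp_pos {ι : Type*} [Fintype ι] {r : ι → ℝ} (hr : ∀ j, 0 ≤ r j)
    (hr1 : ∑ j, r j = 1) (y : ι → ℝ) : 0 < ∑ j, r j * Real.exp (y j) := by
  refine lt_of_le_of_ne (Finset.sum_nonneg fun j _ => mul_nonneg (hr j) (Real.exp_pos _).le)
    fun h => ?_
  have hz := (Finset.sum_eq_zero_iff_of_nonneg
    fun j _ => mul_nonneg (hr j) (Real.exp_pos (y j)).le).1 h.symm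
  have : ∑ j, r j = 0 := Finset.sum_eq_zero fun j hj =>
    (mul_eq_zero.1 (hz j hj)).resolve_right (Real.exp_ne_zero _)
  linarith

/-- The larger of the exponential moments under `q^L` and `q^R`. -/
noncomputable def maxExpMoment (N : ℕ) (Γ : ℝ) (y : Fin (N + 2) → ℝ) : ℝ :=
  max (∑ j, qL N Γ j * Real.exp (y j)) (∑ j, qR N Γ j * Real.exp (y j))

theorem maxExpMoment_pos (hN : 1 ≤ N) (h0 : 0 ≤ Γ) (h1 : Γ ≤ 1) (y : Fin (N + 2) → ℝ) :
    0 < maxExpMoment N Γ y :=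
  lt_max_of_lt_left (sum_mul_exp_pos (qL_nonneg h0 h1) (sum_qL hN h0) y)

theorem sum_mixture_mul_exp (t : ℝ) (y : Fin (N + 2) → ℝ) :
    ∑ j, (t * qL N Γ j + (1 - t) * qR N Γ j) * Real.exp (y j) =
      t * ∑ j, qL N Γ j * Real.exp (y j) + (1 - t) * ∑ j, qR N Γ j * Real.exp (y j) := by
  rw [Finset.mul_sum, Finset.mul_sum, ← Finset.sum_add_distrib]
  exact Finset.sum_congr rfl fun j _ => by ring

theorem sum_mul_sum_div {v : Fin d → ℝ} {u : Fin d → ℝ} {q : Fin d → Fin (N + 2) → ℝ} {l : ℝ}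
    (hl : l ≠ 0) (hu : ∀ i, ∑ j, x i j * q i j = u i) :
    ∑ i, v i * u i = l * ∑ i, ∑ j, q i j * (v i * x i j / l) := by
  rw [Finset.mul_sum]
  refine Finset.sum_congr rfl fun i _ => ?_
  rw [← hu i, Finset.mul_sum, Finset.mul_sum]
  refine Finset.sum_congr rfl fun j _ => ?_
  field_simp

theorem sub_mul_le_of_mem_entropyEpigraph (hN : 1 ≤ N) (h0 : 0 ≤ Γ) (h1 : Γ ≤ 1)
    {z : (Fin d → ℝ) × ℝ} (hz : z ∈ entropyEpigraph x Γ) (v : Fin d → ℝ) {l : ℝ} (hl : 0 < l) :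
    ∑ i, v i * z.1 i - l * z.2 ≤
      l * ∑ i, Real.log (maxExpMoment N Γ fun j => v i * x i j / l) := by
  obtain ⟨θ, q, hθ, hq, hz, hac, hD⟩ := hz
  have key : ∀ i, ∑ j, q i j * (v i * x i j / l) -
      ∑ j, q i j * Real.log (q i j / (θ i * qL N Γ j + (1 - θ i) * qR N Γ j)) ≤
      Real.log (maxExpMoment N Γ fun j => v i * x i j / l) := by
    intro i
    have hA := sum_mul_exp_pos (qL_nonneg h0 h1) (sum_qL hN h0) fun j => v i * x i j / l
    have hB := sum_mul_exp_pos (qR_nonneg h0 h1) (sum_qR hN h0) fun j => v i * x i j / l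
    have hpos := sum_mul_exp_pos (mixture_nonneg (N := N) h0 h1 (hθ i)) (by
      rw [Finset.sum_add_distrib, ← Finset.mul_sum, ← Finset.mul_sum, sum_qL hN h0, sum_qR hN h0]
      ring) fun j => v i * x i j / l
    refine (sum_mul_sub_entropy_le_log (hq i) (mixture_nonneg h0 h1 (hθ i)) (hac i) _ hpos).trans
      (Real.log_le_log hpos ?_)
    rw [sum_mixture_mul_exp]
    obtain ⟨ht0, ht1⟩ := hθ i
    have hA' := le_max_left (∑ j, qL N Γ j * Real.exp (v i * x i j / l))
      (∑ j, qR N Γ j * Real.exp (v i * x i j / l))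
    have hB' := le_max_right (∑ j, qL N Γ j * Real.exp (v i * x i j / l))
      (∑ j, qR N Γ j * Real.exp (v i * x i j / l))
    rw [maxExpMoment]
    nlinarith [mul_le_mul_of_nonneg_left hA' ht0, mul_le_mul_of_nonneg_left hB' (sub_nonneg.2 ht1)]
  have hsum := mul_le_mul_of_nonneg_left (Finset.sum_le_sum fun i (_ : i ∈ Finset.univ) => key i)
    hl.le
  rw [Finset.sum_sub_distrib, mul_sub, ← sum_mul_sum_div hl.ne' hz] at hsum
  have := mul_le_mul_of_nonneg_left hD hl.le
  linarith

theorem exists_mem_entropyEpigraph_sub_mul_eq (hN : 1 ≤ N) (h0 : 0 ≤ Γ) (h1 : Γ ≤ 1)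
    (x : Fin d → Fin (N + 2) → ℝ) (v : Fin d → ℝ) {l : ℝ} (hl : 0 < l) :
    ∃ z ∈ entropyEpigraph x Γ, 0 ≤ z.2 ∧ ∑ i, v i * z.1 i - l * z.2 =
      l * ∑ i, Real.log (maxExpMoment N Γ fun j => v i * x i j / l) := by
  have key : ∀ i, ∃ t ∈ Set.Icc (0 : ℝ) 1, ∃ q ∈ stdSimplex ℝ (Fin (N + 2)),
      (∀ j, t * qL N Γ j + (1 - t) * qR N Γ j = 0 → q j = 0) ∧
      ∑ j, q j * (v i * x i j / l) -
        ∑ j, q j * Real.log (q j / (t * qL N Γ j + (1 - t) * qR N Γ j)) =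
      Real.log (maxExpMoment N Γ fun j => v i * x i j / l) := by
    intro i
    rcases le_total (∑ j, qR N Γ j * Real.exp (v i * x i j / l))
      (∑ j, qL N Γ j * Real.exp (v i * x i j / l)) with h | h
    · obtain ⟨q, hq, hac, he⟩ := exists_sum_mul_sub_entropy_eq_log (qL_nonneg h0 h1)
        (fun j => v i * x i j / l) (sum_mul_exp_pos (qL_nonneg h0 h1) (sum_qL hN h0) _)
      refine ⟨1, by simp, q, hq, by simpa using hac, ?_⟩
      rw [maxExpMoment, max_eq_left h, ← he]
      simp
    · obtain ⟨q, hq, hac, he⟩ := exists_sum_mul_sub_entropy_eq_log (qR_nonneg h0 h1)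
        (fun j => v i * x i j / l) (sum_mul_exp_pos (qR_nonneg h0 h1) (sum_qR hN h0) _)
      refine ⟨0, by simp, q, hq, by simpa using hac, ?_⟩
      rw [maxExpMoment, max_eq_right h, ← he]
      simp
  choose θ hθ q hq hac he using key
  refine ⟨(fun i => ∑ j, x i j * q i j, ∑ i, ∑ j, q i j *
    Real.log (q i j / (θ i * qL N Γ j + (1 - θ i) * qR N Γ j))), ⟨θ, q, hθ, hq, fun _ => rfl, hac, le_rfl⟩, ?_, ?_⟩
  · change (0 : ℝ) ≤ ∑ i, ∑ j, q i j *
      Real.log (q i j / (θ i * qL N Γ j + (1 - θ i) * qR N Γ j))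
    refine Finset.sum_nonneg fun i _ => ?_
    have hpos : ∑ j, (θ i * qL N Γ j + (1 - θ i) * qR N Γ j) = 1 := by
      rw [Finset.sum_add_distrib, ← Finset.mul_sum, ← Finset.mul_sum, sum_qL hN h0, sum_qR hN h0]
      ring
    have := sum_mul_sub_entropy_le_log (hq i) (mixture_nonneg h0 h1 (hθ i)) (hac i)
      (fun _ => 0) (by simp [hpos])
    simp [hpos] at this
    exact this
  · rw [← Finset.sum_congr rfl fun i _ => he i, Finset.sum_sub_distrib, mul_sub,
      ← sum_mul_sum_div hl.ne' fun _ => rfl]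

theorem exists_mem_entropyEpigraph_zero (hN : 1 ≤ N) (h0 : 0 ≤ Γ) (h1 : Γ ≤ 1)
    (x : Fin d → Fin (N + 2) → ℝ) : ∃ u, (u, (0 : ℝ)) ∈ entropyEpigraph x Γ := by
  refine ⟨fun i => ∑ j, x i j * qL N Γ j, fun _ => 1, fun _ => qL N Γ, by simp,
    fun i => ⟨qL_nonneg h0 h1, sum_qL hN h0⟩, fun _ => rfl, by simp, ?_⟩
  refine Finset.sum_nonpos fun i _ => Finset.sum_nonpos fun j _ => ?_
  by_cases h : qL N Γ j = 0 <;> simp [h]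

end Epigraph

section Duality

variable {d N : ℕ} {a b : Fin d → ℝ} {Γ : ℝ} {S : Fin N → Fin d → ℝ} {ε : ℝ}

theorem convex_uncertaintySet (h0 : 0 ≤ Γ) (h1 : Γ ≤ 1) :
    Convex ℝ (uncertaintySet a b Γ S ε) := by
  intro u hu u' hu' s t hs ht hst
  rw [mem_uncertaintySet_iff] at *
  have := convex_entropyEpigraph h0 h1 hu hu' hs ht hst
  rwa [Prod.smul_mk, Prod.smul_mk, Prod.mk_add_mk, ← add_smul, hst, one_smul] at this

/-- Weak duality. -/
theorem sum_mul_le_dualObjective (hN : 1 ≤ N) (h0 : 0 ≤ Γ) (h1 : Γ ≤ 1) {u : Fin d → ℝ}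
    (hu : u ∈ uncertaintySet a b Γ S ε) (v : Fin d → ℝ) {l : ℝ} (hl : 0 < l) :
    ∑ i, v i * u i ≤ dualObjective a b Γ S ε v l := by
  have := sub_mul_le_of_mem_entropyEpigraph hN h0 h1 (mem_uncertaintySet_iff.1 hu) v hl
  unfold maxExpMoment at this
  unfold dualObjective
  linarith

/-- Strong duality. -/
theorem exists_dualObjective_lt (hN : 1 ≤ N) (h0 : 0 ≤ Γ) (h1 : Γ ≤ 1)
    (hε : ε ∈ Set.Ioo (0 : ℝ) 1) {v : Fin d → ℝ} {c c' : ℝ} (hcc' : c < c')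
    (hc : ∀ u ∈ uncertaintySet a b Γ S ε, ∑ i, v i * u i ≤ c) :
    ∃ l : ℝ, 0 < l ∧ dualObjective a b Γ S ε v l < c' := by
  set x : Fin d → Fin (N + 2) → ℝ := fun i => orderPoints (a i) (b i) fun k => S k i with hx
  have hρ : 0 < Real.log (1 / ε) := Real.log_pos (one_lt_one_div hε.1 hε.2)
  set ρ := Real.log (1 / ε) with hρdef
  let L : ((Fin d → ℝ) × ℝ) →ₗ[ℝ] ℝ × ℝ :=
    ((∑ i, v i • LinearMap.proj i : (Fin d → ℝ) →ₗ[ℝ] ℝ)).prodMap LinearMap.id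
  have hL : ∀ z, L z = (∑ i, v i * z.1 i, z.2) := by
    intro z
    simp [L, LinearMap.prodMap_apply]
  obtain ⟨u₀, hu₀⟩ := exists_mem_entropyEpigraph_zero hN h0 h1 x
  obtain ⟨l, hl, hmul⟩ := exists_lagrange_multiplier (c := c)
    ((convex_entropyEpigraph (x := x) h0 h1).linear_image L) hρ (s₀ := ∑ i, v i * u₀ i)
    ⟨_, hu₀, hL _⟩ (by
      rintro _ ⟨z, hz, rfl⟩ hle
      rw [hL] at hle ⊢
      refine hc _ (mem_uncertaintySet_iff.2 ?_)
      obtain ⟨θ, q, hθ, hq, hz, hac, hD⟩ := hz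
      exact ⟨θ, q, hθ, hq, hz, hac, hD.trans hle⟩)
  set δ := (c' - c) / (2 * ρ) with hδ
  have hδ0 : 0 < δ := div_pos (by linarith) (by linarith)
  obtain ⟨z, hz, hz0, hze⟩ :=
    exists_mem_entropyEpigraph_sub_mul_eq hN h0 h1 x v (l := l + δ) (by linarith)
  refine ⟨l + δ, by linarith, ?_⟩
  have h2 := hmul _ ⟨z, hz, rfl⟩
  rw [hL] at h2
  have h3 : dualObjective a b Γ S ε v (l + δ) =
      (l + δ) * ρ + (∑ i, v i * z.1 i - (l + δ) * z.2) := by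
    rw [hze]
    rfl
  rw [h3]
  have h4 : δ * ρ = (c' - c) / 2 := by
    rw [hδ]
    field_simp
  have h5 : 0 ≤ δ * z.2 := mul_nonneg hδ0.le hz0
  simp only at h2
  nlinarith

theorem supportFunction_uncertaintySet (hN : 1 ≤ N) (h0 : 0 ≤ Γ) (h1 : Γ ≤ 1)
    (hε : ε ∈ Set.Ioo (0 : ℝ) 1) (v : Fin d → ℝ) :
    supportFunction v (uncertaintySet a b Γ S ε) =
      ⨅ l ∈ Set.Ioi (0 : ℝ), ((dualObjective a b Γ S ε v l : ℝ) : EReal) := by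
  refine le_antisymm (iSup₂_le fun u hu => le_iInf₂ fun l hl => EReal.coe_le_coe_iff.2
    (sum_mul_le_dualObjective hN h0 h1 hu v hl)) ?_
  refine EReal.le_of_forall_lt_iff_le.1 fun c' hc' => ?_
  obtain ⟨c, hc, hcc'⟩ := EReal.exists_between_coe_real hc'
  obtain ⟨l, hl, hlt⟩ := exists_dualObjective_lt (S := S) (a := a) (b := b) (v := v) hN h0 h1 hε
    (EReal.coe_lt_coe_iff.1 hcc') fun u hu => EReal.coe_le_coe_iff.1 <|
      (le_iSup₂ (f := fun (u : Fin d → ℝ) (_ : u ∈ uncertaintySet a b Γ S ε) =>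
        ((∑ i, v i * u i : ℝ) : EReal)) u hu).trans hc.le
  exact (iInf₂_le l hl).trans (EReal.coe_le_coe_iff.2 hlt.le)

end Duality

/-! ### Order statistics and stochastic dominance -/

section OrderPoints

variable {N : ℕ} {a b : ℝ} {s : Fin N → ℝ}

theorem orderPoints_last : orderPoints a b s (Fin.last (N + 1)) = b := by
  rw [orderPoints, ← Fin.succ_last, Fin.cons_succ, Fin.snoc_last]

theorem orderPoints_succ_castSucc (i : Fin N) :
    orderPoints a b s i.castSucc.succ = sortedSample s i := by
  rw [orderPoints, Fin.cons_succ, Fin.snoc_castSucc]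

theorem monotone_sortedSample (s : Fin N → ℝ) : Monotone (sortedSample s) :=
  Tuple.monotone_sort s

theorem card_filter_sortedSample (s : Fin N → ℝ) (p : ℝ → Prop) [DecidablePred p] :
    (Finset.univ.filter fun k => p (sortedSample s k)).card =
      (Finset.univ.filter fun k => p (s k)).card :=
  Finset.card_equiv (Tuple.sort s) fun i => by
    rw [Finset.mem_filter, Finset.mem_filter]
    simp [sortedSample]

theorem sum_qL_orderPoints_lt {Γ : ℝ} (h0 : 0 ≤ Γ) (h1 : Γ ≤ 1) {t : ℝ} (ht : a < t) :
    min 1 (Γ + (Finset.univ.filter fun k => s k < t).card / N) ≤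
      ∑ j with orderPoints a b s j < t, qL N Γ j := by
  refine (sum_qL_filter_le h0 h1 ((Finset.card_filter_le _ _).trans (by simp))).trans
    (Finset.sum_le_sum_of_subset_of_nonneg (fun j hj => ?_) fun j _ _ => qL_nonneg h0 h1 j)
  rw [Finset.mem_filter] at hj ⊢
  refine ⟨Finset.mem_univ _, ?_⟩
  obtain ⟨-, hj⟩ := hj
  have hcard : (Finset.univ.filter fun k => s k < t).card ≤ N :=
    (Finset.card_filter_le _ _).trans (by simp)
  obtain rfl | ⟨i, rfl⟩ := j.eq_zero_or_eq_succ
  · exact ht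
  · rw [Fin.val_succ] at hj
    obtain ⟨i', rfl⟩ : ∃ i' : Fin N, i = i'.castSucc := ⟨⟨i, by omega⟩, rfl⟩
    rw [orderPoints_succ_castSucc, ← Tuple.lt_card_lt_iff_apply_lt_of_monotone
      (monotone_sortedSample s), card_filter_sortedSample s (· < t)]
    exact hj

theorem sum_qR_lt_orderPoints {Γ : ℝ} (h0 : 0 ≤ Γ) (h1 : Γ ≤ 1) {t : ℝ} (ht : t < b) :
    min 1 (Γ + (Finset.univ.filter fun k => t < s k).card / N) ≤
      ∑ j with t < orderPoints a b s j, qR N Γ j := by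
  have hrev : ∑ j with t < orderPoints a b s j, qR N Γ j =
      ∑ j with t < orderPoints a b s (Fin.rev j), qL N Γ j :=
    Finset.sum_equiv Fin.revPerm (by simp) (by simp [qR])
  rw [hrev]
  refine (sum_qL_filter_le h0 h1 ((Finset.card_filter_le _ _).trans (by simp))).trans
    (Finset.sum_le_sum_of_subset_of_nonneg (fun j hj => ?_) fun j _ _ => qL_nonneg h0 h1 j)
  rw [Finset.mem_filter] at hj ⊢
  refine ⟨Finset.mem_univ _, ?_⟩
  obtain ⟨-, hj⟩ := hj
  have hcard : (Finset.univ.filter fun k => t < s k).card ≤ N :=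
    (Finset.card_filter_le _ _).trans (by simp)
  obtain rfl | ⟨i, rfl⟩ := j.eq_zero_or_eq_succ
  · rwa [Fin.rev_zero, orderPoints_last]
  · rw [Fin.val_succ] at hj
    obtain ⟨i', rfl⟩ : ∃ i' : Fin N, i = i'.castSucc := ⟨⟨i, by omega⟩, rfl⟩
    have hr : Fin.rev i'.castSucc.succ = (Fin.rev i').castSucc.succ := by
      ext
      simp [Fin.val_rev]
      omega
    rw [hr, orderPoints_succ_castSucc]
    have hanti : Antitone fun k : Fin N => sortedSample s (Fin.rev k) :=
      fun k l hkl => monotone_sortedSample s (Fin.rev_le_rev.2 hkl)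
    refine (Tuple.lt_card_gt_iff_apply_gt_of_antitone hanti (a := t) (j := i')).1 ?_
    have hc : (Finset.univ.filter fun k => t < sortedSample s (Fin.rev k)).card =
        (Finset.univ.filter fun k => t < sortedSample s k).card :=
      Finset.card_equiv Fin.revPerm fun i => by simp
    rw [hc, card_filter_sortedSample s (t < ·)]
    exact hj

end OrderPoints

/-- A comparison of tail probabilities implies a comparison of expectations. -/
theorem lintegral_ofReal_le_of_tail_le {ι : Type*} [Fintype ι] {μ : Measure ℝ} {w x : ι → ℝ}
    (hw : ∀ j, 0 ≤ w j) {g : ℝ → ℝ} (hg : Measurable g) (hg0 : ∀ y, 0 ≤ g y)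
    (h : ∀ r : ℝ, 0 < r → μ {y | r < g y} ≤ ENNReal.ofReal (∑ j with r < g (x j), w j)) :
    ∫⁻ y, ENNReal.ofReal (g y) ∂μ ≤ ENNReal.ofReal (∑ j, w j * g (x j)) := by
  classical
  set ν : Measure ℝ := ∑ j, ENNReal.ofReal (w j) • Measure.dirac (x j) with hν
  have hν1 : ∫⁻ y, ENNReal.ofReal (g y) ∂ν = ENNReal.ofReal (∑ j, w j * g (x j)) := by
    rw [hν, lintegral_finsetSum_measure,
      ENNReal.ofReal_sum_of_nonneg fun j _ => mul_nonneg (hw j) (hg0 _)]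
    refine Finset.sum_congr rfl fun j _ => ?_
    rw [lintegral_smul_measure, lintegral_dirac' _ hg.ennreal_ofReal, smul_eq_mul,
      ENNReal.ofReal_mul (hw j)]
  have hν2 : ∀ r : ℝ, ν {y | r < g y} = ENNReal.ofReal (∑ j with r < g (x j), w j) := by
    intro r
    rw [hν, Measure.finsetSum_apply, Finset.sum_filter,
      ENNReal.ofReal_sum_of_nonneg fun j _ => by split_ifs; exacts [hw j, le_rfl]]
    refine Finset.sum_congr rfl fun j _ => ?_
    rw [Measure.smul_apply, Measure.dirac_apply' _ (measurableSet_lt measurable_const hg)]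
    by_cases hr : r < g (x j) <;> simp [hr]
  rw [← hν1, lintegral_eq_lintegral_meas_lt μ (.of_forall hg0) hg.aemeasurable,
    lintegral_eq_lintegral_meas_lt ν (.of_forall hg0) hg.aemeasurable]
  refine setLIntegral_mono' measurableSet_Ioi fun r hr => ?_
  rw [hν2]
  exact h r hr

/-- The empirical distribution function of `s` is within `Γ` of the distribution function of `μ`. -/
def InCdfBand {N : ℕ} (μ : Measure ℝ) (Γ : ℝ) (s : Fin N → ℝ) : Prop :=
  ∀ q : ℚ, μ.real (Set.Iic (q : ℝ)) ≤ (Finset.univ.filter fun k => s k ≤ q).card / N + Γ ∧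
    ((Finset.univ.filter fun k => s k ≤ q).card : ℝ) / N ≤ μ.real (Set.Iic (q : ℝ)) + Γ

section Band

variable {N : ℕ} {μ : Measure ℝ} [IsProbabilityMeasure μ] {Γ : ℝ} {s : Fin N → ℝ}

theorem InCdfBand.real_Iio_le (h : InCdfBand μ Γ s) (t : ℝ) :
    μ.real (Set.Iio t) ≤ Γ + (Finset.univ.filter fun k => s k < t).card / N := by
  obtain ⟨q, hmono, hlt, htend⟩ := Real.exists_seq_rat_strictMono_tendsto t
  have hU : Set.Iio t = ⋃ n, Set.Iic (q n : ℝ) := by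
    ext y
    simp only [Set.mem_Iio, Set.mem_iUnion, Set.mem_Iic]
    refine ⟨fun hy => ?_, fun ⟨n, hn⟩ => hn.trans_lt (hlt n)⟩
    obtain ⟨n, hn⟩ := (htend.eventually (lt_mem_nhds hy)).exists
    exact ⟨n, hn.le⟩
  have hlim := tendsto_measure_iUnion_atTop (μ := μ) (s := fun n => Set.Iic (q n : ℝ))
    fun m n hmn => Set.Iic_subset_Iic.2 (by exact_mod_cast hmono.monotone hmn)
  rw [← hU] at hlim
  refine le_of_tendsto ((ENNReal.tendsto_toReal (measure_ne_top μ _)).comp hlim)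
    (.of_forall fun n => ((h (q n)).1.trans_eq (add_comm _ _)).trans ?_)
  refine add_le_add le_rfl (div_le_div_of_nonneg_right (Nat.cast_le.2
    (Finset.card_le_card ?_)) (Nat.cast_nonneg _))
  exact Finset.monotone_filter_right _ fun k _ hk => lt_of_le_of_lt hk (hlt n)

theorem InCdfBand.real_Ioi_le (hN : 1 ≤ N) (h : InCdfBand μ Γ s) (t : ℝ) :
    μ.real (Set.Ioi t) ≤ Γ + (Finset.univ.filter fun k => t < s k).card / N := by
  obtain ⟨q, hmono, hlt, htend⟩ := Real.exists_seq_rat_strictAnti_tendsto t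
  have hU : Set.Ioi t = ⋃ n, Set.Ioi (q n : ℝ) := by
    ext y
    simp only [Set.mem_Ioi, Set.mem_iUnion]
    refine ⟨fun hy => ?_, fun ⟨n, hn⟩ => (hlt n).trans hn⟩
    exact (htend.eventually (gt_mem_nhds hy)).exists
  have hlim := tendsto_measure_iUnion_atTop (μ := μ) (s := fun n => Set.Ioi (q n : ℝ))
    fun m n hmn => Set.Ioi_subset_Ioi (by exact_mod_cast hmono.antitone hmn)
  rw [← hU] at hlim
  refine le_of_tendsto ((ENNReal.tendsto_toReal (measure_ne_top μ _)).comp hlim)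
    (.of_forall fun n => ?_)
  have h1 : μ.real (Set.Ioi (q n : ℝ)) = 1 - μ.real (Set.Iic (q n : ℝ)) := by
    rw [← Set.compl_Iic, probReal_compl_eq_one_sub measurableSet_Iic]
  have h2 : ((Finset.univ.filter fun k => s k ≤ q n).card : ℝ) / N =
      1 - (Finset.univ.filter fun k => (q n : ℝ) < s k).card / N := by
    have := Finset.card_filter_add_card_filter_not (s := (Finset.univ : Finset (Fin N)))
      (fun k => s k ≤ q n)
    simp only [not_le, Finset.card_univ, Fintype.card_fin] at this
    have h3 : (N : ℝ) ≠ 0 := by positivity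
    rw [eq_sub_iff_add_eq, ← add_div, div_eq_one_iff_eq h3]
    exact_mod_cast this
  have h4 : ((Finset.univ.filter fun k => (q n : ℝ) < s k).card : ℝ) / N ≤
      (Finset.univ.filter fun k => t < s k).card / N := by
    refine div_le_div_of_nonneg_right (Nat.cast_le.2 (Finset.card_le_card ?_)) (Nat.cast_nonneg _)
    exact Finset.monotone_filter_right _ fun k _ hk => (hlt n).trans hk
  have h5 := (h (q n)).2
  change μ.real (Set.Ioi (q n : ℝ)) ≤ _
  linarith

/-- The exponential moment of a distribution on `[a, b]` in the band is at most the larger of the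
exponential moments of the two extreme distributions. -/
theorem InCdfBand.lintegral_exp_le (hN : 1 ≤ N) (h0 : 0 ≤ Γ) (h1 : Γ ≤ 1)
    (h : InCdfBand μ Γ s) {a b : ℝ} (hab : ∀ᵐ y ∂μ, y ∈ Set.Icc a b) (c : ℝ) :
    ∫⁻ y, ENNReal.ofReal (Real.exp (c * y)) ∂μ ≤
      ENNReal.ofReal (maxExpMoment N Γ fun j => c * orderPoints a b s j) := by
  have hmeas : Measurable fun y : ℝ => Real.exp (c * y) := by fun_prop
  have hprob : ∀ T : Set ℝ, ∀ r : ℝ, μ.real T ≤ r → μ T ≤ ENNReal.ofReal (min 1 r) := by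
    intro T r hT
    rw [← ofReal_measureReal (measure_ne_top μ T)]
    exact ENNReal.ofReal_le_ofReal (le_min measureReal_le_one hT)
  rcases lt_trichotomy c 0 with hc | rfl | hc
  · refine (lintegral_ofReal_le_of_tail_le (qL_nonneg h0 h1) hmeas (fun _ => (Real.exp_pos _).le)
      (x := orderPoints a b s) fun r hr => ?_).trans (ENNReal.ofReal_le_ofReal (le_max_left _ _))
    have hiff : ∀ y, r < Real.exp (c * y) ↔ y < Real.log r / c := fun y => by
      rw [← Real.log_lt_iff_lt_exp hr, lt_div_iff_of_neg hc, mul_comm]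
    simp only [hiff]
    rcases le_or_gt (Real.log r / c) a with ht | ht
    · have : μ {y | y < Real.log r / c} = 0 := by
        refine measure_mono_null (fun y hy => ?_) (ae_iff.1 hab)
        exact fun hy' => absurd (hy'.1.trans_lt (show y < _ from hy)) (not_lt.2 ht)
      rw [this]
      exact zero_le
    · exact (hprob _ _ (h.real_Iio_le _)).trans
        (ENNReal.ofReal_le_ofReal (sum_qL_orderPoints_lt h0 h1 ht))
  · simp [maxExpMoment, sum_qL hN h0]
  · refine (lintegral_ofReal_le_of_tail_le (qR_nonneg h0 h1) hmeas (fun _ => (Real.exp_pos _).le)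
      (x := orderPoints a b s) fun r hr => ?_).trans (ENNReal.ofReal_le_ofReal (le_max_right _ _))
    have hiff : ∀ y, r < Real.exp (c * y) ↔ Real.log r / c < y := fun y => by
      rw [← Real.log_lt_iff_lt_exp hr, div_lt_iff₀ hc, mul_comm]
    simp only [hiff]
    rcases le_or_gt b (Real.log r / c) with ht | ht
    · have : μ {y | Real.log r / c < y} = 0 := by
        refine measure_mono_null (fun y hy => ?_) (ae_iff.1 hab)
        exact fun hy' => absurd ((show _ < y from hy).trans_le hy'.2) (not_lt.2 ht)
      rw [this]
      exact zero_le
    · exact (hprob _ _ (h.real_Ioi_le hN _)).trans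
        (ENNReal.ofReal_le_ofReal (sum_qR_lt_orderPoints h0 h1 ht))

theorem measurableSet_inCdfBand (N : ℕ) (μ : Measure ℝ) (Γ : ℝ) :
    MeasurableSet {s : Fin N → ℝ | InCdfBand μ Γ s} := by
  have hm : ∀ q : ℚ, Measurable fun s : Fin N → ℝ =>
      ((Finset.univ.filter fun k => s k ≤ q).card : ℝ) := by
    intro q
    simp_rw [Finset.card_filter, Nat.cast_sum, Nat.cast_ite]
    refine Finset.measurable_sum _ fun k _ => ?_
    exact Measurable.ite (measurableSet_le (measurable_pi_apply k) measurable_const)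
      measurable_const measurable_const
  simp only [InCdfBand, Set.ofPred_forall]
  refine MeasurableSet.iInter fun q => ?_
  exact (measurableSet_le measurable_const (((hm q).div_const _).add_const _)).inter
    (measurableSet_le ((hm q).div_const _) measurable_const)

end Band

/-! ### The probabilistic guarantee -/

section Guarantee

variable {d N : ℕ} {a b : Fin d → ℝ} {Γ ε : ℝ} {S : Fin N → Fin d → ℝ}
  {P : Measure (Fin d → ℝ)} [IsProbabilityMeasure P]

/-- The Chernoff bound at a point above the dual objective. -/
theorem measure_le_of_dualObjective_le (hN : 1 ≤ N) (h0 : 0 ≤ Γ) (h1 : Γ ≤ 1)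
    (hε : ε ∈ Set.Ioo (0 : ℝ) 1)
    (hindep : iIndepFun (fun (i : Fin d) (u : Fin d → ℝ) => u i) P)
    (hab : ∀ᵐ u ∂P, u ∈ Set.Icc a b)
    (hband : ∀ i, InCdfBand (P.map fun u => u i) Γ fun k => S k i)
    (v : Fin d → ℝ) {l c : ℝ} (hl : 0 < l) (hc : dualObjective a b Γ S ε v l ≤ c) :
    P {u | c ≤ ∑ i, v i * u i} ≤ ENNReal.ofReal ε := by
  set M : Fin d → ℝ := fun i =>
    maxExpMoment N Γ fun j => v i * orderPoints (a i) (b i) (fun k => S k i) j / l with hM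
  have hMpos : ∀ i, 0 < M i := fun i => maxExpMoment_pos hN h0 h1 _
  have hc' : l * Real.log (1 / ε) + l * ∑ i, Real.log (M i) ≤ c := hc
  have hmarg : ∀ i, ∫⁻ u, ENNReal.ofReal (Real.exp (v i / l * u i)) ∂P ≤
      ENNReal.ofReal (M i) := by
    intro i
    have := Measure.isProbabilityMeasure_map (μ := P) (measurable_pi_apply i).aemeasurable
    have hmeas : Measurable fun y : ℝ => ENNReal.ofReal (Real.exp (v i / l * y)) := by fun_prop
    rw [← lintegral_map hmeas (measurable_pi_apply i)]
    have hsup : ∀ᵐ y ∂(P.map fun u => u i), y ∈ Set.Icc (a i) (b i) := by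
      refine (ae_map_iff (measurable_pi_apply i).aemeasurable measurableSet_Icc).2 ?_
      filter_upwards [hab] with u hu
      exact ⟨hu.1 i, hu.2 i⟩
    refine ((hband i).lintegral_exp_le hN h0 h1 hsup (v i / l)).trans_eq ?_
    simp only [hM, div_mul_eq_mul_div]
  have hprod : ∫⁻ u, ENNReal.ofReal (Real.exp ((∑ i, v i * u i) / l)) ∂P ≤
      ENNReal.ofReal (∏ i, M i) := by
    have hmeas : ∀ i, Measurable fun y : ℝ => ENNReal.ofReal (Real.exp (v i / l * y)) :=
      fun i => by fun_prop
    have hfac := lintegral_prod_eq_prod_lintegral_of_indepFun Finset.univ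
      (fun i (u : Fin d → ℝ) => ENNReal.ofReal (Real.exp (v i / l * u i)))
      (hindep.comp _ hmeas) fun i => (hmeas i).comp (measurable_pi_apply i)
    have hexp : ∀ u : Fin d → ℝ, ENNReal.ofReal (Real.exp ((∑ i, v i * u i) / l)) =
        ∏ i, ENNReal.ofReal (Real.exp (v i / l * u i)) := by
      intro u
      rw [← ENNReal.ofReal_prod_of_nonneg fun i _ => (Real.exp_pos _).le, ← Real.exp_sum,
        Finset.sum_div]
      simp only [div_mul_eq_mul_div]
    simp_rw [hexp]
    rw [hfac, ENNReal.ofReal_prod_of_nonneg fun i _ => (hMpos i).le]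
    exact Finset.prod_le_prod' fun i _ => hmarg i
  have hmarkov := meas_ge_le_lintegral_div (μ := P)
    (f := fun u : Fin d → ℝ => ENNReal.ofReal (Real.exp ((∑ i, v i * u i) / l)))
    ((Real.measurable_exp.comp ((Finset.measurable_sum _ fun i _ =>
      measurable_const.mul (measurable_pi_apply i)).div_const l)).ennreal_ofReal.aemeasurable)
    (ε := ENNReal.ofReal (Real.exp (c / l)))
    (by simpa using Real.exp_pos _) ENNReal.ofReal_ne_top
  refine (measure_mono fun u hu => ?_).trans (hmarkov.trans
    ((ENNReal.div_le_div_right hprod _).trans ?_))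
  · refine ENNReal.ofReal_le_ofReal (Real.exp_le_exp.2 ?_)
    have : c ≤ ∑ i, v i * u i := hu
    gcongr
  · rw [← ENNReal.ofReal_div_of_pos (Real.exp_pos _)]
    refine ENNReal.ofReal_le_ofReal ?_
    have hpe : ∏ i, M i = Real.exp (∑ i, Real.log (M i)) := by
      rw [Real.exp_sum]
      exact Finset.prod_congr rfl fun i _ => (Real.exp_log (hMpos i)).symm
    rw [hpe, ← Real.exp_sub]
    refine (Real.exp_le_exp.2 ?_).trans_eq (Real.exp_log hε.1)
    rw [one_div, Real.log_inv] at hc'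
    have : -Real.log ε + ∑ i, Real.log (M i) ≤ c / l := by
      rw [le_div_iff₀ hl]
      linarith
    linarith

theorem impliesGuarantee_uncertaintySet (hN : 1 ≤ N) (h0 : 0 ≤ Γ) (h1 : Γ ≤ 1)
    (hε : ε ∈ Set.Ioo (0 : ℝ) 1)
    (hindep : iIndepFun (fun (i : Fin d) (u : Fin d → ℝ) => u i) P)
    (hab : ∀ᵐ u ∂P, u ∈ Set.Icc a b)
    (hband : ∀ i, InCdfBand (P.map fun u => u i) Γ fun k => S k i) :
    ImpliesGuarantee P ε (uncertaintySet a b Γ S ε) := by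
  intro k f hf x hx
  have hcont : Continuous fun u => f u x := (hf x).locallyLipschitz.continuous
  have hO : IsOpen {u | 0 < f u x} := isOpen_lt continuous_const hcont
  have hOc : Convex ℝ {u | 0 < f u x} := by simpa using (hf x).convex_gt 0
  have hdisj : Disjoint {u | 0 < f u x} (uncertaintySet a b Γ S ε) := by
    rw [Set.disjoint_left]
    exact fun u hu huU => absurd (hx u huU) (not_le.2 hu)
  obtain ⟨φ, w, hφO, hφU⟩ :=
    geometric_hahn_banach_open hOc hO (convex_uncertaintySet h0 h1) hdisj
  set v : Fin d → ℝ := fun i => -φ (Pi.single i 1) with hv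
  have hφ : ∀ u, ∑ i, v i * u i = -φ u := by
    intro u
    have := LinearMap.pi_apply_eq_sum_univ (φ : (Fin d → ℝ) →ₗ[ℝ] ℝ) u
    simp only [ContinuousLinearMap.coe_coe, smul_eq_mul] at this
    rw [this, ← Finset.sum_neg_distrib]
    refine Finset.sum_congr rfl fun i _ => ?_
    simp only [hv, neg_mul, mul_comm (u i)]
    congr 3
    ext j
    simp [Pi.single_apply, eq_comm]
  have hbound : ∀ n : ℕ, P {u | -w + 1 / ((n : ℝ) + 1) ≤ ∑ i, v i * u i} ≤ ENNReal.ofReal ε := by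
    intro n
    obtain ⟨l, hl, hlt⟩ := exists_dualObjective_lt (S := S) (a := a) (b := b) (v := v) hN h0 h1 hε
      (lt_add_of_pos_right (-w) (Nat.one_div_pos_of_nat (α := ℝ) (n := n)))
      fun u hu => by rw [hφ]; exact neg_le_neg (hφU u hu)
    exact measure_le_of_dualObjective_le hN h0 h1 hε hindep hab hband v hl hlt.le
  have hPO : P {u | 0 < f u x} ≤ ENNReal.ofReal ε := by
    have hsub : {u | 0 < f u x} ⊆ ⋃ n : ℕ, {u | -w + 1 / ((n : ℝ) + 1) ≤ ∑ i, v i * u i} := by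
      intro u hu
      have h2 := hφO u hu
      obtain ⟨n, hn⟩ := exists_nat_one_div_lt (sub_pos.2 h2)
      refine Set.mem_iUnion.2 ⟨n, ?_⟩
      rw [Set.mem_ofPred_eq, hφ]
      linarith
    refine (measure_mono hsub).trans ?_
    rw [Monotone.measure_iUnion]
    · exact iSup_le hbound
    · intro m n hmn u hu
      refine le_trans ?_ (show -w + 1 / ((m : ℝ) + 1) ≤ ∑ i, v i * u i from hu)
      gcongr
  have hcompl : {u | f u x ≤ 0} = {u | 0 < f u x}ᶜ := by
    ext u
    simp
  rw [hcompl, prob_compl_eq_one_sub hO.measurableSet, ENNReal.ofReal_sub _ hε.1.le,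
    ENNReal.ofReal_one]
  exact tsub_le_tsub_left hPO 1

end Guarantee

/-! ### The Kolmogorov-Smirnov statistic of a uniform sample -/

instance : IsProbabilityMeasure uniformUnit := ⟨by simp [uniformUnit]⟩

theorem uniformUnit_Iic {c : ℝ} (hc : c ∈ Set.Icc (0 : ℝ) 1) :
    uniformUnit (Set.Iic c) = ENNReal.ofReal c := by
  rw [uniformUnit, Measure.restrict_apply measurableSet_Iic]
  have : Set.Iic c ∩ Set.Icc 0 1 = Set.Icc 0 c := by
    ext y
    simp only [Set.mem_inter_iff, Set.mem_Iic, Set.mem_Icc]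
    exact ⟨fun h => ⟨h.2.1, h.1⟩, fun h => ⟨h.2, h.1, h.2.trans hc.2⟩⟩
  rw [this, Real.volume_Icc, sub_zero]

theorem uniformUnit_real_Iic {c : ℝ} (hc : c ∈ Set.Icc (0 : ℝ) 1) :
    uniformUnit.real (Set.Iic c) = c := by
  rw [Measure.real, uniformUnit_Iic hc, ENNReal.toReal_ofReal hc.1]

theorem uniformUnit_real_Iio {c : ℝ} (hc : c ∈ Set.Icc (0 : ℝ) 1) :
    uniformUnit.real (Set.Iio c) = c := by
  have : NullSingletonClass uniformUnit := by unfold uniformUnit; infer_instance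
  rw [measureReal_congr Iio_ae_eq_Iic, uniformUnit_real_Iic hc]

theorem ae_uniformUnit_mem_Ioo : ∀ᵐ p ∂uniformUnit, p ∈ Set.Ioo (0 : ℝ) 1 := by
  rw [uniformUnit, ← Measure.restrict_congr_set Ioo_ae_eq_Icc]
  exact ae_restrict_mem measurableSet_Ioo

section Statistic

variable {N : ℕ} (s : Fin N → ℝ) (μ : Measure ℝ)

theorem le_ksStatistic (j : Fin N) :
    max (((j : ℝ) + 1) / N - μ.real (Set.Iic (sortedSample s j)))
      (μ.real (Set.Iio (sortedSample s j)) - (j : ℝ) / N) ≤ ksStatistic s μ :=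
  le_ciSup (f := fun j : Fin N => max (((j : ℝ) + 1) / N - μ.real (Set.Iic (sortedSample s j)))
      (μ.real (Set.Iio (sortedSample s j)) - (j : ℝ) / N)) (Set.finite_range _).bddAbove j

theorem ksStatistic_nonneg [IsProbabilityMeasure μ] (hN : 1 ≤ N) : 0 ≤ ksStatistic s μ := by
  refine le_trans ?_ ((le_max_left _ _).trans (le_ksStatistic s μ ⟨N - 1, by omega⟩))
  have h1 : μ.real (Set.Iic (sortedSample s ⟨N - 1, by omega⟩)) ≤ 1 := measureReal_le_one
  have h2 : (((N - 1 : ℕ) : ℝ) + 1) / N = 1 := by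
    rw [Nat.cast_sub hN, Nat.cast_one, sub_add_cancel, div_self (by positivity)]
  simp only at h1 ⊢
  linarith

theorem ksStatistic_le_one [IsProbabilityMeasure μ] (hN : 1 ≤ N) : ksStatistic s μ ≤ 1 := by
  have : Nonempty (Fin N) := ⟨⟨0, by omega⟩⟩
  refine ciSup_le fun j => max_le ?_ ?_
  · have h1 : (0 : ℝ) ≤ μ.real (Set.Iic (sortedSample s j)) := measureReal_nonneg
    have h2 : ((j : ℝ) + 1) / N ≤ 1 := by
      refine div_le_one_of_le₀ ?_ (Nat.cast_nonneg _)
      exact_mod_cast j.2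
    linarith
  · have h1 : μ.real (Set.Iio (sortedSample s j)) ≤ 1 := measureReal_le_one
    have h2 : (0 : ℝ) ≤ (j : ℝ) / N := by positivity
    linarith

end Statistic

section Threshold

variable {N : ℕ} {β Γ : ℝ}

theorem one_mem_thresholds (hN : 1 ≤ N) :
    (1 : ℝ) ∈ {t : ℝ | Measure.pi (fun _ : Fin N => uniformUnit)
      {s | t < ksStatistic s uniformUnit} ≤ ENNReal.ofReal β} := by
  have : {s : Fin N → ℝ | 1 < ksStatistic s uniformUnit} = ∅ :=
    Set.eq_empty_of_forall_notMem fun s => not_lt.2 (ksStatistic_le_one s _ hN)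
  rw [Set.mem_ofPred_eq, this]
  simp

theorem ksThreshold_nonneg (hN : 1 ≤ N) (hβ : β < 1) : 0 ≤ ksThreshold N β := by
  refine le_csInf ⟨1, one_mem_thresholds hN⟩ fun t ht => ?_
  by_contra! h
  have : {s : Fin N → ℝ | t < ksStatistic s uniformUnit} = Set.univ :=
    Set.eq_univ_of_forall fun s => h.trans_le (ksStatistic_nonneg s _ hN)
  rw [Set.mem_ofPred_eq, this, measure_univ, ENNReal.one_le_ofReal] at ht
  linarith

theorem measure_lt_ksStatistic_le (hN : 1 ≤ N) (hΓ : ksThreshold N β ≤ Γ) :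
    Measure.pi (fun _ : Fin N => uniformUnit) {s | Γ < ksStatistic s uniformUnit} ≤
      ENNReal.ofReal β := by
  have hU : {s : Fin N → ℝ | Γ < ksStatistic s uniformUnit} =
      ⋃ n : ℕ, {s | Γ + 1 / ((n : ℝ) + 1) < ksStatistic s uniformUnit} := by
    ext s
    simp only [Set.mem_ofPred_eq, Set.mem_iUnion]
    constructor
    · intro h
      obtain ⟨n, hn⟩ := exists_nat_one_div_lt (sub_pos.2 h)
      exact ⟨n, by linarith⟩
    · rintro ⟨n, hn⟩
      exact (lt_add_of_pos_right Γ Nat.one_div_pos_of_nat).trans hn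
  rw [hU, Monotone.measure_iUnion]
  · refine iSup_le fun n => ?_
    obtain ⟨t, ht, htn⟩ := exists_lt_of_csInf_lt ⟨1, one_mem_thresholds (β := β) hN⟩
      (hΓ.trans_lt (lt_add_of_pos_right Γ (Nat.one_div_pos_of_nat (α := ℝ) (n := n))))
    exact (measure_mono fun s hs => htn.trans hs).trans ht
  · intro m n hmn s hs
    refine lt_of_le_of_lt ?_ (show Γ + 1 / ((m : ℝ) + 1) < ksStatistic s uniformUnit from hs)
    gcongr

/-- The Kolmogorov-Smirnov band of a uniform sample, read at a point `c`. -/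
theorem cdf_band_of_ksStatistic_le (hN : 1 ≤ N) (h0 : 0 ≤ Γ) {p : Fin N → ℝ}
    (hp : ∀ k, p k ∈ Set.Ioo (0 : ℝ) 1) (hks : ksStatistic p uniformUnit ≤ Γ) {c : ℝ}
    (hc : c ∈ Set.Icc (0 : ℝ) 1) :
    c ≤ (Finset.univ.filter fun k => p k ≤ c).card / N + Γ ∧
      ((Finset.univ.filter fun k => p k ≤ c).card : ℝ) / N ≤ c + Γ := by
  have hs : ∀ j, sortedSample p j ∈ Set.Icc (0 : ℝ) 1 := fun j => Set.Ioo_subset_Icc_self (hp _)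
  have hiff : ∀ j : Fin N, (j : ℕ) < (Finset.univ.filter fun k => p k ≤ c).card ↔
      sortedSample p j ≤ c := by
    intro j
    rw [← Tuple.lt_card_le_iff_apply_le_of_monotone (monotone_sortedSample p),
      card_filter_sortedSample p (· ≤ c)]
  set n := (Finset.univ.filter fun k => p k ≤ c).card with hn
  have hnN : n ≤ N := (Finset.card_filter_le _ _).trans (by simp)
  constructor
  · rcases hnN.lt_or_eq with h | h
    · have h1 : c < sortedSample p ⟨n, h⟩ := by
        rw [← not_le, ← hiff]
        exact lt_irrefl n
      have h2 := ((le_max_right _ _).trans (le_ksStatistic p uniformUnit ⟨n, h⟩)).trans hks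
      rw [uniformUnit_real_Iio (hs _)] at h2
      simp only at h2
      linarith
    · rw [h, div_self (by positivity)]
      linarith [hc.2]
  · rcases Nat.eq_zero_or_pos n with h | h
    · rw [h]
      simp only [Nat.cast_zero, zero_div]
      linarith [hc.1]
    · have h1 : sortedSample p ⟨n - 1, by omega⟩ ≤ c := (hiff _).1 (by simp; omega)
      have h2 := ((le_max_left _ _).trans
        (le_ksStatistic p uniformUnit ⟨n - 1, by omega⟩)).trans hks
      rw [uniformUnit_real_Iic (hs _)] at h2
      simp only [Nat.cast_sub (show 1 ≤ n from h), Nat.cast_one, sub_add_cancel] at h2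
      linarith

end Threshold

/-! ### The quantile transform -/

/-- The quantile function of a probability distribution on the line, set to `0` off `(0, 1)`. -/
noncomputable def quantile (μ : Measure ℝ) (p : ℝ) : ℝ :=
  open scoped Classical in
  if p ∈ Set.Ioo (0 : ℝ) 1 then sInf {x | p ≤ cdf μ x} else 0

section Quantile

variable (μ : Measure ℝ)

theorem quantile_le_iff {p : ℝ} (hp : p ∈ Set.Ioo (0 : ℝ) 1) (x : ℝ) :
    quantile μ p ≤ x ↔ p ≤ cdf μ x := by
  rw [quantile, if_pos hp]
  have hne : {x | p ≤ cdf μ x}.Nonempty :=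
    ((tendsto_cdf_atTop μ).eventually (le_mem_nhds hp.2)).exists
  have hbdd : BddBelow {x | p ≤ cdf μ x} := by
    obtain ⟨y, hy⟩ := ((tendsto_cdf_atBot μ).eventually (gt_mem_nhds hp.1)).exists
    refine ⟨y, fun z hz => ?_⟩
    by_contra! h
    exact absurd ((monotone_cdf μ h.le).trans_lt hy) (not_lt.2 hz)
  refine ⟨fun h => ?_, fun h => csInf_le hbdd h⟩
  have hr : Filter.Tendsto (cdf μ) (nhdsWithin x (Set.Ioi x)) (nhds (cdf μ x)) :=
    ((cdf μ).right_continuous x).mono Set.Ioi_subset_Ici_self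
  refine ge_of_tendsto hr (eventually_nhdsWithin_of_forall fun y hy => ?_)
  obtain ⟨z, hz, hzy⟩ := exists_lt_of_csInf_lt hne (h.trans_lt hy)
  exact le_trans hz (monotone_cdf μ hzy.le)

theorem measurable_quantile : Measurable (quantile μ) := by
  refine measurable_of_Iic fun x => ?_
  have : quantile μ ⁻¹' Set.Iic x =
      (Set.Ioo 0 1 ∩ Set.Iic (cdf μ x)) ∪ ((Set.Ioo 0 1)ᶜ ∩ {_p | (0 : ℝ) ≤ x}) := by
    ext p
    by_cases hp : p ∈ Set.Ioo (0 : ℝ) 1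
    · simp only [Set.mem_preimage, Set.mem_Iic, quantile_le_iff μ hp, Set.mem_union,
        Set.mem_inter_iff, hp, Set.mem_compl_iff, true_and, not_true, false_and, or_false]
    · simp only [Set.mem_preimage, Set.mem_Iic, quantile, Set.mem_union, if_false,
        Set.mem_inter_iff, hp, Set.mem_compl_iff, true_and, not_false_eq_true, false_and,
        false_or, Set.mem_ofPred_eq]
  rw [this]
  exact (measurableSet_Ioo.inter measurableSet_Iic).union
    (measurableSet_Ioo.compl.inter (.const _))

theorem map_quantile_uniformUnit [IsProbabilityMeasure μ] :
    uniformUnit.map (quantile μ) = μ := by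
  have := Measure.isProbabilityMeasure_map (μ := uniformUnit) (measurable_quantile μ).aemeasurable
  refine Measure.ext_of_Iic _ _ fun x => ?_
  rw [Measure.map_apply (measurable_quantile μ) measurableSet_Iic, ← ofReal_cdf,
    ← uniformUnit_Iic ⟨cdf_nonneg μ x, cdf_le_one μ x⟩]
  refine measure_congr ?_
  filter_upwards [ae_uniformUnit_mem_Ioo] with p hp
  exact propext (quantile_le_iff μ hp x)

end Quantile

/-- The Kolmogorov-Smirnov band has the required coverage for every distribution on the line,
continuous or not. -/
theorem le_measure_inCdfBand {N : ℕ} (hN : 1 ≤ N) {β Γ : ℝ} (hβ0 : 0 ≤ β) (hβ1 : β < 1)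
    (hΓ : ksThreshold N β ≤ Γ) (μ : Measure ℝ) [IsProbabilityMeasure μ] :
    ENNReal.ofReal (1 - β) ≤ Measure.pi (fun _ : Fin N => μ) {s | InCdfBand μ Γ s} := by
  have h0 : 0 ≤ Γ := (ksThreshold_nonneg hN hβ1).trans hΓ
  have hmap : (Measure.pi fun _ : Fin N => uniformUnit).map (fun p k => quantile μ (p k)) =
      Measure.pi fun _ : Fin N => μ := by
    have := Measure.isProbabilityMeasure_map (μ := uniformUnit)
      (measurable_quantile μ).aemeasurable
    rw [Measure.pi_map_pi fun _ => (measurable_quantile μ).aemeasurable,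
      map_quantile_uniformUnit μ]
  have hmeas : Measurable fun (p : Fin N → ℝ) k => quantile μ (p k) :=
    measurable_pi_lambda _ fun k => (measurable_quantile μ).comp (measurable_pi_apply k)
  have hB := measurableSet_inCdfBand N μ Γ
  rw [← hmap, Measure.map_apply hmeas hB]
  have hcompl : Measure.pi (fun _ : Fin N => uniformUnit)
      ((fun (p : Fin N → ℝ) k => quantile μ (p k)) ⁻¹' {s | InCdfBand μ Γ s})ᶜ ≤
      ENNReal.ofReal β := by
    refine le_trans (measure_mono_ae ?_) (measure_lt_ksStatistic_le hN hΓ)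
    have hae : ∀ᵐ p ∂Measure.pi (fun _ : Fin N => uniformUnit), ∀ k, p k ∈ Set.Ioo (0 : ℝ) 1 :=
      ae_all_iff.2 fun k => (Measure.quasiMeasurePreserving_eval _ k).ae ae_uniformUnit_mem_Ioo
    filter_upwards [hae] with p hp hnot
    by_contra hks
    refine hnot fun q => ?_
    have hq := cdf_band_of_ksStatistic_le hN h0 hp (not_lt.1 hks)
      (c := cdf μ q) ⟨cdf_nonneg μ _, cdf_le_one μ _⟩
    have hfil : (Finset.univ.filter fun k => quantile μ (p k) ≤ q) =
        Finset.univ.filter fun k => p k ≤ cdf μ q :=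
      Finset.filter_congr fun k _ => quantile_le_iff μ (hp k) q
    simpa only [hfil, cdf_eq_real] using hq
  rw [prob_compl_eq_one_sub (hmeas hB)] at hcompl
  rw [ENNReal.ofReal_sub _ hβ0, ENNReal.ofReal_one]
  exact tsub_le_iff_left.2 (tsub_le_iff_right.1 hcompl)

/-- Rows and columns of an array of independent entries. -/
theorem pi_pi_map_swap {ι κ : Type*} [Fintype ι] [Fintype κ] (μ : ι → Measure ℝ)
    [∀ i, IsProbabilityMeasure (μ i)] :
    (Measure.pi fun i => Measure.pi fun _ : κ => μ i).map (fun T k i => T i k) =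
      Measure.pi fun _ : κ => Measure.pi μ := by
  have hmeas : Measurable fun (T : ι → κ → ℝ) (k : κ) (i : ι) => T i k := by fun_prop
  symm
  refine Measure.pi_eq_generateFrom
    (C := fun _ => Set.pi Set.univ '' Set.pi Set.univ fun _ : ι => {s : Set ℝ | MeasurableSet s})
    (fun _ => generateFrom_pi) (fun _ => isPiSystem_pi)
    (fun _ => Measure.FiniteSpanningSetsIn.pi fun i => (μ i).toFiniteSpanningSetsIn) fun s hs => ?_
  choose t ht hts using hs
  have ht' : ∀ k i, MeasurableSet (t k i) := fun k i => ht k i (Set.mem_univ _)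
  rw [Measure.map_apply hmeas (.univ_pi fun k => hts k ▸ .univ_pi (ht' k))]
  have hpre : (fun (T : ι → κ → ℝ) (k : κ) (i : ι) => T i k) ⁻¹' Set.pi Set.univ s =
      Set.pi Set.univ fun i => Set.pi Set.univ fun k => t k i := by
    ext T
    simp only [← hts, Set.mem_preimage, Set.mem_pi, Set.mem_univ, true_imp_iff]
    exact forall_comm
  rw [hpre]
  simp_rw [← hts, Measure.pi_pi]
  exact Finset.prod_comm

theorem theorem5 (d N : ℕ) (hd : 1 ≤ d) (hN : 1 ≤ N)
    (α : ℝ) (hα : α ∈ Set.Ioo (0 : ℝ) 1)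
    (a b : Fin d → ℝ)
    (P : Measure (Fin d → ℝ)) [IsProbabilityMeasure P]
    (hsupp : P.support ⊆ Set.Icc a b)
    (hindep : iIndepFun (fun (i : Fin d) (u : Fin d → ℝ) => u i) P)
    (Γ : ℝ) (hΓ : ksThreshold N (1 - (1 - α) ^ (1 / (d : ℝ))) ≤ Γ) (hΓ1 : Γ ≤ 1) :
    (∃ A : Set (Fin N → Fin d → ℝ), MeasurableSet A ∧
      ENNReal.ofReal (1 - α) ≤ Measure.pi (fun _ : Fin N => P) A ∧
      ∀ S ∈ A, SimultaneouslyImpliesGuarantee P (fun ε => uncertaintySet a b Γ S ε)) ∧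
    ∀ (S : Fin N → Fin d → ℝ), ∀ ε ∈ Set.Ioo (0 : ℝ) 1, ∀ v : Fin d → ℝ,
      supportFunction v (uncertaintySet a b Γ S ε) =
        ⨅ l ∈ Set.Ioi (0 : ℝ), ((dualObjective a b Γ S ε v l : ℝ) : EReal) := by
  have hα0 : 0 < 1 - α := by linarith [hα.2]
  set γ := (1 - α) ^ (1 / (d : ℝ)) with hγ
  have hγ0 : 0 < γ := Real.rpow_pos_of_pos hα0 _
  have hγ1 : γ ≤ 1 := Real.rpow_le_one hα0.le (by linarith [hα.1]) (by positivity)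
  have hγd : γ ^ d = 1 - α := by
    rw [hγ, one_div, Real.rpow_inv_natCast_pow hα0.le (by omega)]
  have h0 : 0 ≤ Γ := (ksThreshold_nonneg hN (by linarith)).trans hΓ
  refine ⟨?_, fun S ε hε v => supportFunction_uncertaintySet hN h0 hΓ1 hε v⟩
  have hab : ∀ᵐ u ∂P, u ∈ Set.Icc a b := Filter.mem_of_superset Measure.support_mem_ae hsupp
  have hprob : ∀ i, IsProbabilityMeasure (P.map fun u => u i) := fun i =>
    Measure.isProbabilityMeasure_map (measurable_pi_apply i).aemeasurable
  have hP : P = Measure.pi fun i => P.map fun u => u i := by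
    have := (iIndepFun_iff_map_fun_eq_pi_map fun i => (measurable_pi_apply i).aemeasurable).1 hindep
    rwa [Measure.map_id'] at this
  set A : Set (Fin N → Fin d → ℝ) :=
    {S | ∀ i, InCdfBand (P.map fun u => u i) Γ fun k => S k i} with hA
  have hAmeas : MeasurableSet A := by
    rw [hA, Set.ofPred_forall]
    refine MeasurableSet.iInter fun i => ?_
    exact (show Measurable fun (S : Fin N → Fin d → ℝ) k => S k i by fun_prop)
      (measurableSet_inCdfBand N _ Γ)
  refine ⟨A, hAmeas, ?_, fun S hS ε hε =>
    impliesGuarantee_uncertaintySet hN h0 hΓ1 hε hindep hab hS⟩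
  have hswap : Measure.pi (fun _ : Fin N => P) =
      (Measure.pi fun i => Measure.pi fun _ : Fin N => P.map fun u => u i).map
        (fun T k i => T i k) := by
    rw [pi_pi_map_swap, ← hP]
  rw [hswap, Measure.map_apply (by fun_prop) hAmeas]
  have hpre : (fun (T : Fin d → Fin N → ℝ) (k : Fin N) (i : Fin d) => T i k) ⁻¹' A =
      Set.pi Set.univ fun i => {s | InCdfBand (P.map fun u => u i) Γ s} := by
    ext T
    simp [hA, Set.mem_pi]
  rw [hpre, Measure.pi_pi, ← hγd, ENNReal.ofReal_pow hγ0.le]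
  have hcol : ∀ i, ENNReal.ofReal γ ≤ Measure.pi (fun _ : Fin N => P.map fun u => u i)
      {s | InCdfBand (P.map fun u => u i) Γ s} := fun i => by
    have := le_measure_inCdfBand hN (by linarith) (by linarith) hΓ (P.map fun u => u i)
    rwa [sub_sub_cancel] at this
  simpa using Finset.prod_le_prod' fun i (_ : i ∈ Finset.univ) => hcol i
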